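/- Let $h:\mathbb{P}^N(\overline{\mathbb{Q}})\to\mathbb{R}_{\ge 0}$ be the absolute logarithmic Weil height. Let $S$ be a finite set of endomorphisms (self-morphisms) of $\mathbb{P}^N$ over $\overline{\mathbb{Q}}$, all of degree at least two, and let $\nu$ be a probability measure on $S$. Let $\Phi_S=S^{\mathbb{N}}$ be the set of sequences $\gamma=(\theta_1,\theta_2,\dots)$ of elements of $S$, with the product measure $\bar\nu=\prod_{i\ge1}\nu$. For $\gamma\in\Phi_S$ put $\gamma_0^{\pm}=\mathrm{id}$ and, for $n\ge1$, $$\gamma_n^-=\theta_n\circ\theta_{n-1}\circ\cdots\circ\theta_1,\qquad \gamma_n^+=\theta_1\circ\theta_2\circ\cdots\circ\theta_n,$$ and let $\mathrm{Orb}_\gamma^{\pm}(P)=\{\gamma_n^{\pm}(P):n\ge0\}$ be the left ($-$) and right ($+$) orbits of $P$, regarded as sets of points. Let $$C_S=\sup_{\phi\in S}\ \sup_{P\in\mathbb{P}^N(\overline{\mathbb{Q}})}\big|h(\phi(P))-\deg(\phi)\,h(P)\big|,\qquad d_S=\min_{\phi\in S}\deg(\phi),\qquad B_S=\frac{C_S}{d_S-1}.$$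 Then $C_S$ is finite, and there is a real number $\delta_{S,\nu}$ (the dynamical degree of $(S,\nu)$), given by $\delta_{S,\nu}=\prod_{\phi\in S}\deg(\phi)^{\nu(\phi)}$, such that $\lim_{n\to\infty}\deg(\gamma_n^-)^{1/n}=\delta_{S,\nu}=\lim_{n\to\infty}\deg(\gamma_n^+)^{1/n}$ for $\bar\nu$-almost every $\gamma\in\Phi_S$. Moreover, for $\bar\nu$-almost every $\gamma\in\Phi_S$ the limits $$\lim_{B\to\infty}\frac{\#\{Q\in\mathrm{Orb}_\gamma^-(P):h(Q)\le B\}}{\log B}=\frac{1}{\log\delta_{S,\nu}}=\lim_{B\to\infty}\frac{\#\{W\in\mathrm{Orb}_\gamma^+(P):h(W)\le B\}}{\log B}$$ hold simultaneously for all $P\in\mathbb{P}^N(\overline{\mathbb{Q}})$ with $h(P)>3B_S$. -/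

import Mathlib

open MeasureTheory Filter Topology
open scoped LinearAlgebra.Projectivization

noncomputable section

namespace ProjDyn

/-- The field of algebraic numbers. -/
abbrev QBar : Type := AlgebraicClosure ℚ

/-- The set of points of projective `N`-space over the algebraic numbers. -/
abbrev PN (N : ℕ) : Type := ℙ QBar (Fin (N + 1) → QBar)

/-! ### The absolute logarithmic Weil height -/

/-- The number field generated by the coordinates of a vector. -/
def coordField {N : ℕ} (x : Fin (N + 1) → QBar) : IntermediateField ℚ QBar :=
  IntermediateField.adjoin ℚ (Set.range x)

instance instNumberFieldCoordField {N : ℕ} (x : Fin (N + 1) → QBar) :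
    NumberField (coordField x) where
  to_charZero := inferInstance
  to_finiteDimensional := by
    have : FiniteDimensional ℚ (IntermediateField.adjoin ℚ (Set.range x)) :=
      IntermediateField.finiteDimensional_adjoin
        fun y _ => (AlgebraicClosure.isAlgebraic ℚ).isIntegral.isIntegral y
    exact this

/-- A vector, seen as a vector over the number field generated by its coordinates. -/
def coordVec {N : ℕ} (x : Fin (N + 1) → QBar) : Fin (N + 1) → coordField x :=
  fun i => ⟨x i, IntermediateField.subset_adjoin ℚ (Set.range x) ⟨i, rfl⟩⟩

/-- The absolute logarithmic Weil height `h(P) = [K : ℚ]⁻¹ log H_K(x₀, …, x_N)`, where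
`(x₀, …, x_N)` are homogeneous coordinates of `P` and `K` is the number field they generate.
(As is well known, the value depends neither on the chosen coordinates nor on the chosen
number field containing them.) -/
def weilHeight {N : ℕ} (P : PN N) : ℝ :=
  Height.logHeight (coordVec P.rep) / (Module.finrank ℚ (coordField P.rep) : ℝ)

/-! ### Endomorphisms of projective space -/

/-- `F` is a tuple of `N + 1` homogeneous polynomials of degree `d` in `N + 1` variables, without
common zero in projective space, and `f` is the map `[x] ↦ [F₀(x) : … : F_N(x)]`. -/
structure IsPresentedBy {N : ℕ} (f : PN N → PN N) (d : ℕ)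
    (F : Fin (N + 1) → MvPolynomial (Fin (N + 1)) QBar) : Prop where
  homogeneous : ∀ i, (F i).IsHomogeneous d
  eval_ne_zero : ∀ v : Fin (N + 1) → QBar, v ≠ 0 → (fun i => MvPolynomial.eval v (F i)) ≠ 0
  apply_mk : ∀ (v : Fin (N + 1) → QBar) (hv : v ≠ 0),
    f (Projectivization.mk QBar v hv) =
      Projectivization.mk QBar (fun i => MvPolynomial.eval v (F i)) (eval_ne_zero v hv)

/-- An endomorphism (self-morphism) of projective `N`-space over the algebraic numbers,
given by its map on points. -/
@[ext]
structure Endo (N : ℕ) where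
  /-- the map on points -/
  toFun : PN N → PN N
  isMorphism : ∃ d F, IsPresentedBy toFun d F

namespace Endo

variable {N : ℕ}

instance : CoeFun (Endo N) (fun _ => PN N → PN N) := ⟨Endo.toFun⟩

/-- The degree of an endomorphism: the common degree `d` of homogeneous polynomials without
common zero that present it. (For `N ≥ 1` there is exactly one such `d`.) -/
def degree (f : Endo N) : ℕ := sInf {d | ∃ F, IsPresentedBy f.toFun d F}

theorem exists_presentation (f : Endo N) : ∃ F, IsPresentedBy f.toFun f.degree F :=
  Nat.sInf_mem (s := {d | ∃ F, IsPresentedBy f.toFun d F}) f.isMorphism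

/-- The identity map of projective space. -/
def id : Endo N where
  toFun := fun P => P
  isMorphism := ⟨1, MvPolynomial.X, {
    homogeneous := fun i => MvPolynomial.isHomogeneous_X _ i
    eval_ne_zero := fun v hv => by simpa only [MvPolynomial.eval_X] using hv
    apply_mk := fun v hv => by simp only [MvPolynomial.eval_X] }⟩

theorem isPresentedBy_comp {f g : PN N → PN N} {d e : ℕ}
    {F G : Fin (N + 1) → MvPolynomial (Fin (N + 1)) QBar}
    (hF : IsPresentedBy f d F) (hG : IsPresentedBy g e G) :
    IsPresentedBy (f ∘ g) (e * d) (fun i => MvPolynomial.bind₁ G (F i)) := by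
  have key : ∀ v : Fin (N + 1) → QBar,
      (fun i => MvPolynomial.eval v (MvPolynomial.bind₁ G (F i))) =
        fun i => MvPolynomial.eval (fun j => MvPolynomial.eval v (G j)) (F i) := by
    intro v
    funext i
    exact MvPolynomial.eval₂Hom_bind₁ (RingHom.id QBar) v G (F i)
  refine ⟨fun i => (hF.homogeneous i).aeval G hG.homogeneous, fun v hv => ?_, fun v hv => ?_⟩
  · rw [key]
    exact hF.eval_ne_zero _ (hG.eval_ne_zero v hv)
  · simp only [Function.comp_apply, hG.apply_mk v hv, hF.apply_mk, key]

/-- Composition of endomorphisms, `(f.comp g)(P) = f(g(P))`. -/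
def comp (f g : Endo N) : Endo N where
  toFun := fun P => f (g P)
  isMorphism := by
    obtain ⟨d, F, hF⟩ := f.isMorphism
    obtain ⟨e, G, hG⟩ := g.isMorphism
    exact ⟨e * d, _, isPresentedBy_comp hF hG⟩

/-- `C(φ)`, the supremum over all points `P` of `|h(φ(P)) - deg(φ) h(P)|`. -/
def heightDefect (f : Endo N) : ℝ :=
  ⨆ P : PN N, |weilHeight (f P) - (f.degree : ℝ) * weilHeight P|

/-- Finite sets of endomorphisms carry the discrete σ-algebra. -/
instance : MeasurableSpace (Endo N) := ⊤

end Endo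

variable {N : ℕ}

/-! ### The constants attached to a set of endomorphisms -/

/-- `d_S`, the infimum of the degrees of the maps in `S`. -/
def minDegree (S : Finset (Endo N)) : ℕ := sInf (Endo.degree '' (S : Set (Endo N)))

/-- `C_S`, the supremum of the constants `C(φ)` for `φ ∈ S`. -/
def maxDefect (S : Finset (Endo N)) : ℝ := sSup (Endo.heightDefect '' (S : Set (Endo N)))

/-- `B_S = C_S / (d_S - 1)`. -/
def escapeConst (S : Finset (Endo N)) : ℝ := maxDefect S / ((minDegree S : ℝ) - 1)

/-! ### Random left and right iteration; a sequence `(θ₁, θ₂, …)` is indexed as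
`γ 0 = θ₁, γ 1 = θ₂, …` -/

/-- `γ_n^- = θ_n ∘ θ_{n-1} ∘ ⋯ ∘ θ_1`. -/
def leftIter {S : Finset (Endo N)} (γ : ℕ → S) : ℕ → Endo N
  | 0 => Endo.id
  | n + 1 => (γ n : Endo N).comp (leftIter γ n)

/-- `γ_n^+ = θ_1 ∘ θ_2 ∘ ⋯ ∘ θ_n`. -/
def rightIter {S : Finset (Endo N)} (γ : ℕ → S) : ℕ → Endo N
  | 0 => Endo.id
  | n + 1 => (rightIter γ n).comp (γ n : Endo N)

/-- The left orbit `{γ_n^-(P) : n ≥ 0}`. -/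
def leftOrbit {S : Finset (Endo N)} (γ : ℕ → S) (P : PN N) : Set (PN N) :=
  Set.range fun n => leftIter γ n P

/-- The right orbit `{γ_n^+(P) : n ≥ 0}`. -/
def rightOrbit {S : Finset (Endo N)} (γ : ℕ → S) (P : PN N) : Set (PN N) :=
  Set.range fun n => rightIter γ n P

/-- The product measure on the space of all sequences of elements of `S`. -/
def seqMeasure {S : Finset (Endo N)} (ν : Measure S) [IsProbabilityMeasure ν] :
    Measure (ℕ → S) :=
  Measure.infinitePi fun _ => ν

/-- `δ` is the dynamical degree of `(S, ν)`: for almost every sequence, both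
`deg(γ_n^-)^{1/n}` and `deg(γ_n^+)^{1/n}` converge to `δ`. -/
def IsDynamicalDegree {S : Finset (Endo N)} (ν : Measure S) [IsProbabilityMeasure ν]
    (δ : ℝ) : Prop :=
  ∀ᵐ γ ∂(seqMeasure ν),
    Tendsto (fun n : ℕ => ((leftIter γ n).degree : ℝ) ^ (1 / (n : ℝ))) atTop (𝓝 δ) ∧
    Tendsto (fun n : ℕ => ((rightIter γ n).degree : ℝ) ^ (1 / (n : ℝ))) atTop (𝓝 δ)

end ProjDyn

end

open ProjDyn

/-! Write h for the height and B for `escapeConst S`. Each φ in S satisfies |h(φ(P)) - deg(φ) h(P)|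
≤ B (deg(φ) - 1), and this form of error is stable under composition
(`Endo.abs_weilHeight_comp_sub_le`). Hence both n-th iterates satisfy |h(γ_n(P)) - D_n h(P)| ≤ B
(D_n - 1), where D_n is the product of the first n degrees, the same on the left and on the right.
As D_n at least doubles, h(P) > 3B makes the heights along the orbit strictly increasing. Orbit
points are then distinct, and counting them amounts to inverting the growth of log h(γ_n(P)) / n,
which has the limit of log D_n / n. The strong law of large numbers identifies that limit as log δ,
almost surely and independently of P.

The arithmetic input is the finiteness of each defect: `absLogHeight_eval_le` bounds h(φ(P)) above,
and `le_absLogHeight_eval` bounds it below by the Nullstellensatz. Both rest on computing heights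
over any sufficiently large number field (`absLogHeight_coe`). Unboundedness of h for N ≥ 1 makes
the degree well defined and multiplicative. -/

namespace ProjDyn

open Height NumberField

/-! ### Heights under extension of number fields -/

section Extension

variable {K L : Type*} [Field K] [NumberField K] [Field L] [NumberField L] [Algebra K L]

/-- The multiplicity of an infinite place counts the embeddings inducing it. In terms of embeddings,
passing to `L` only requires counting extensions. -/
theorem prod_infinitePlace_pow_mult_eq_prod_embeddings {ι : Type*} (x : ι → K) :
    ∏ v : InfinitePlace K, (⨆ i, v (x i)) ^ v.mult = ∏ φ : K →+* ℂ, ⨆ i, ‖φ (x i)‖ := by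
  classical
  rw [← Finset.prod_fiberwise Finset.univ InfinitePlace.mk (fun φ : K →+* ℂ => ⨆ i, ‖φ (x i)‖)]
  refine Finset.prod_congr rfl fun v _ => ?_
  rw [← InfinitePlace.card_filter_mk_eq, ← Finset.prod_const]
  refine Finset.prod_congr rfl fun φ hφ => ?_
  rw [← (Finset.mem_filter.mp hφ).2]
  rfl

theorem card_embeddings_extending (φ : K →+* ℂ) [DecidableEq (K →+* ℂ)] :
    (Finset.univ.filter fun ψ : L →+* ℂ => ψ.comp (algebraMap K L) = φ).card =
      Module.finrank K L := by
  classical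
  have : FiniteDimensional K L := Module.Finite.of_restrictScalars_finite ℚ K L
  let := φ.toAlgebra
  rw [← AlgHom.card K L ℂ, ← Fintype.card_subtype]
  refine Fintype.card_congr ⟨fun ψ => ⟨ψ.1, fun r => DFunLike.congr_fun ψ.2 r⟩,
    fun σ => ⟨σ.toRingHom, RingHom.ext fun r => σ.commutes r⟩, fun _ => rfl, fun _ => rfl⟩

theorem prod_embeddings_algebraMap {ι : Type*} (x : ι → K) :
    ∏ ψ : L →+* ℂ, (⨆ i, ‖ψ (algebraMap K L (x i))‖) =
      (∏ φ : K →+* ℂ, ⨆ i, ‖φ (x i)‖) ^ Module.finrank K L := by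
  classical
  rw [← Finset.prod_fiberwise Finset.univ (fun ψ : L →+* ℂ => ψ.comp (algebraMap K L)),
    ← Finset.prod_pow]
  refine Finset.prod_congr rfl fun φ _ => ?_
  rw [← card_embeddings_extending (L := L) φ, ← Finset.prod_const]
  refine Finset.prod_congr rfl fun ψ hψ => ?_
  rw [← (Finset.mem_filter.mp hψ).2]
  rfl

/-- For integral coordinates the finite part is the inverse norm of the ideal they generate, and
extending an ideal to `L` raises its norm to the power `[L : K]`. No splitting of places is needed.
-/
theorem finprod_finitePlace_algebraMap {ι : Type*} [Finite ι] {x : ι → 𝓞 K} (hx : x ≠ 0) :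
    ∏ᶠ w : FinitePlace L, ⨆ i, w (algebraMap K L (x i)) =
      (∏ᶠ v : FinitePlace K, ⨆ i, v (x i : K)) ^ Module.finrank K L := by
  have hy : (fun i => algebraMap (𝓞 K) (𝓞 L) (x i)) ≠ 0 := by
    obtain ⟨i, hi⟩ := Function.ne_iff.mp hx
    exact Function.ne_iff.mpr ⟨i, by
      simpa using (map_ne_zero_iff _ (FaithfulSMul.algebraMap_injective (𝓞 K) (𝓞 L))).mpr hi⟩
  have h1 := absNorm_mul_finprod_finitePlace_eq_one hx
  have h2 := absNorm_mul_finprod_finitePlace_eq_one hy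
  have h3 : Ideal.span (Set.range fun i => algebraMap (𝓞 K) (𝓞 L) (x i)) =
      (Ideal.span (Set.range x)).map (algebraMap (𝓞 K) (𝓞 L)) := by
    rw [Ideal.map_span, ← Set.range_comp]; rfl
  rw [h3, Ideal.absNorm_algebraMap, ← IsFractionRing.finrank_eq (𝓞 K) K (𝓞 L) L] at h2
  have h4 : ((Ideal.span (Set.range x)).absNorm : ℝ) ≠ 0 := left_ne_zero_of_mul_eq_one h1
  refine mul_left_cancel₀ (pow_ne_zero (Module.finrank K L) h4) ?_
  rw [← mul_pow, h1, one_pow]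
  exact_mod_cast h2

theorem mulHeight_algebraMap_of_integral {ι : Type*} [Finite ι] (x : ι → 𝓞 K) :
    mulHeight (fun i => algebraMap K L (x i)) =
      mulHeight (fun i => (x i : K)) ^ Module.finrank K L := by
  rcases eq_or_ne x 0 with rfl | hx
  · simp
  have hx' : (fun i => (x i : K)) ≠ 0 := by
    obtain ⟨i, hi⟩ := Function.ne_iff.mp hx
    exact Function.ne_iff.mpr ⟨i, by simpa using hi⟩
  have hx'' : (fun i => algebraMap K L (x i)) ≠ 0 := by
    obtain ⟨i, hi⟩ := Function.ne_iff.mp hx'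
    exact Function.ne_iff.mpr ⟨i, by simpa using hi⟩
  rw [NumberField.mulHeight_eq hx', NumberField.mulHeight_eq hx'',
    prod_infinitePlace_pow_mult_eq_prod_embeddings, prod_infinitePlace_pow_mult_eq_prod_embeddings,
    prod_embeddings_algebraMap (L := L) (fun i => (x i : K)), finprod_finitePlace_algebraMap hx,
    mul_pow]

/-- The multiplicative height relative to an extension of number fields. -/
theorem mulHeight_algebraMap {ι : Type*} [Finite ι] (x : ι → K) :
    mulHeight (fun i => algebraMap K L (x i)) = mulHeight x ^ Module.finrank K L := by
  -- Clear denominators: scaling by `b` changes neither height.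
  obtain ⟨b, hb⟩ := IsLocalization.exist_integer_multiples_of_finite
    (nonZeroDivisors (𝓞 K)) x
  choose y hy using hb
  have hb0 : ((b : 𝓞 K) : K) ≠ 0 := by
    simp
  have h := mulHeight_algebraMap_of_integral (L := L) y
  have e1 : (fun i => (y i : K)) = ((b : 𝓞 K) : K) • x := by
    funext i; simpa [Algebra.smul_def] using hy i
  have e2 : (fun i => algebraMap K L (y i)) =
      (algebraMap K L ((b : 𝓞 K) : K)) • (fun i => algebraMap K L (x i)) := by
    funext i
    have := congrFun e1 i
    simp only [Pi.smul_apply, smul_eq_mul] at this ⊢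
    rw [this, map_mul]
  rwa [e1, e2, mulHeight_smul_eq_mulHeight _ hb0,
    mulHeight_smul_eq_mulHeight _ (by simp)] at h

theorem logHeight_algebraMap {ι : Type*} [Finite ι] (x : ι → K) :
    logHeight (fun i => algebraMap K L (x i)) = Module.finrank K L * logHeight x := by
  rw [logHeight_eq_log_mulHeight, mulHeight_algebraMap, Real.log_pow, logHeight_eq_log_mulHeight]

theorem logHeight_algebraMap_div_finrank {ι : Type*} [Finite ι] (x : ι → K) :
    logHeight (fun i => algebraMap K L (x i)) / Module.finrank ℚ L =
      logHeight x / Module.finrank ℚ K := by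
  have : FiniteDimensional K L := Module.Finite.of_restrictScalars_finite ℚ K L
  have h : (Module.finrank K L : ℝ) ≠ 0 := by exact_mod_cast Module.finrank_pos.ne'
  rw [logHeight_algebraMap, ← Module.finrank_mul_finrank ℚ K L, Nat.cast_mul,
    mul_comm (Module.finrank ℚ K : ℝ), mul_div_mul_left _ _ h]

end Extension

/-! ### The absolute height of a tuple of algebraic numbers -/

theorem numberField_adjoin_of_finite {s : Set QBar} (hs : s.Finite) :
    NumberField (IntermediateField.adjoin ℚ s) where
  to_charZero := inferInstance
  to_finiteDimensional := by
    have : Finite s := hs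
    exact IntermediateField.finiteDimensional_adjoin
      fun y _ => (AlgebraicClosure.isAlgebraic ℚ).isIntegral.isIntegral y

theorem exists_numberField_of_finite {s : Set QBar} (hs : s.Finite) :
    ∃ K : IntermediateField ℚ QBar, NumberField K ∧ ∀ a ∈ s, a ∈ K :=
  ⟨_, numberField_adjoin_of_finite hs, fun _ ha => IntermediateField.subset_adjoin ℚ s ha⟩

section absLogHeight

variable {ι ι' : Type*} [Finite ι]

instance instNumberFieldAdjoinRange (x : ι → QBar) :
    NumberField (IntermediateField.adjoin ℚ (Set.range x)) :=
  numberField_adjoin_of_finite (Set.finite_range x)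

/-- The absolute logarithmic height of a tuple of algebraic numbers. -/
noncomputable def absLogHeight (x : ι → QBar) : ℝ :=
  logHeight (fun i => (⟨x i, IntermediateField.subset_adjoin ℚ (Set.range x) ⟨i, rfl⟩⟩ :
    IntermediateField.adjoin ℚ (Set.range x))) /
    Module.finrank ℚ (IntermediateField.adjoin ℚ (Set.range x))

/-- Independence of the field: results over a fixed number field transfer once `K` is chosen to
contain all the data. -/
theorem absLogHeight_coe (K : IntermediateField ℚ QBar) [NumberField K] (y : ι → K) :
    absLogHeight (fun i => (y i : QBar)) = logHeight y / Module.finrank ℚ K := by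
  have hle : IntermediateField.adjoin ℚ (Set.range fun i => (y i : QBar)) ≤ K := by
    rw [IntermediateField.adjoin_le_iff]
    rintro _ ⟨i, rfl⟩
    exact (y i).2
  let := (IntermediateField.inclusion hle).toRingHom.toAlgebra
  rw [absLogHeight, ← logHeight_algebraMap_div_finrank (L := K)]
  rfl

theorem absLogHeight_eq {K : IntermediateField ℚ QBar} [NumberField K] {x : ι → QBar}
    (hx : ∀ i, x i ∈ K) :
    absLogHeight x = logHeight (fun i => (⟨x i, hx i⟩ : K)) / Module.finrank ℚ K :=
  absLogHeight_coe K fun i => ⟨x i, hx i⟩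

theorem absLogHeight_nonneg (x : ι → QBar) : 0 ≤ absLogHeight x :=
  div_nonneg (logHeight_nonneg _) (Nat.cast_nonneg _)

theorem absLogHeight_smul (x : ι → QBar) {c : QBar} (hc : c ≠ 0) :
    absLogHeight (c • x) = absLogHeight x := by
  obtain ⟨K, hK, h⟩ := exists_numberField_of_finite ((Set.finite_range x).insert c)
  have hx : ∀ i, x i ∈ K := fun i => h _ (Set.mem_insert_of_mem _ ⟨i, rfl⟩)
  have hcK : c ∈ K := h _ (Set.mem_insert _ _)
  rw [absLogHeight_eq hx, absLogHeight_eq (K := K) (x := c • x) fun i => K.mul_mem hcK (hx i),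
    ← logHeight_smul_eq_logHeight (fun i => (⟨x i, hx i⟩ : K)) (c := (⟨c, hcK⟩ : K))
      fun h0 => hc (congrArg Subtype.val h0)]
  rfl

theorem absLogHeight_linearMap_apply_le [Finite ι'] {κ : Type*} [Fintype κ] (A : ι' × κ → QBar)
    (x : κ → QBar) :
    absLogHeight (fun j => ∑ i, A (j, i) * x i) ≤
      Real.log (Nat.card κ) + absLogHeight A + absLogHeight x := by
  obtain ⟨K, hK, h⟩ := exists_numberField_of_finite ((Set.finite_range x).union (Set.finite_range A))
  have hx : ∀ i, x i ∈ K := fun i => h _ (Or.inl ⟨i, rfl⟩)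
  have hA : ∀ i, A i ∈ K := fun i => h _ (Or.inr ⟨i, rfl⟩)
  have key := logHeight_linearMap_apply_le (fun a => (⟨A a, hA a⟩ : K)) (fun i => ⟨x i, hx i⟩)
  have hd : (0 : ℝ) < Module.finrank ℚ K := by exact_mod_cast Module.finrank_pos
  -- The constant is weighted by `[K : ℚ]`, so division by the degree removes its dependence on `K`.
  rw [totalWeight_eq_finrank] at key
  have e := absLogHeight_coe K (fun j => ∑ i, (⟨A (j, i), hA (j, i)⟩ : K) * (⟨x i, hx i⟩ : K))
  simp only [AddSubmonoidClass.coe_finsetSum, MulMemClass.coe_mul] at e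
  rw [e, absLogHeight_eq hx, absLogHeight_eq hA, div_le_iff₀ hd]
  refine key.trans (le_of_eq ?_)
  field_simp

theorem absLogHeight_tensorPower {x : ι → QBar} (hx : x ≠ 0) (d : ℕ) :
    absLogHeight (fun I : Fin d → ι => ∏ a, x (I a)) = d * absLogHeight x := by
  obtain ⟨K, hK, h⟩ := exists_numberField_of_finite (Set.finite_range x)
  have hxK : ∀ i, x i ∈ K := fun i => h _ ⟨i, rfl⟩
  have hx' : (fun i => (⟨x i, hxK i⟩ : K)) ≠ 0 := by
    obtain ⟨i, hi⟩ := Function.ne_iff.mp hx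
    exact Function.ne_iff.mpr ⟨i, fun h0 => hi (congrArg Subtype.val h0)⟩
  have e := absLogHeight_coe K (fun I : Fin d → ι => ∏ a, (⟨x (I a), hxK (I a)⟩ : K))
  simp only [SubmonoidClass.coe_finsetProd] at e
  rw [e, absLogHeight_eq hxK,
    logHeight_fun_prod_eq (x := fun (_ : Fin d) i => (⟨x i, hxK i⟩ : K)) fun _ => hx']
  simp [mul_div_assoc]

theorem absLogHeight_pow (x : ι → QBar) (n : ℕ) :
    absLogHeight (fun i => x i ^ n) = n * absLogHeight x := by
  obtain ⟨K, hK, h⟩ := exists_numberField_of_finite (Set.finite_range x)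
  have hxK : ∀ i, x i ∈ K := fun i => h _ ⟨i, rfl⟩
  rw [absLogHeight_eq hxK, absLogHeight_eq (K := K) (x := fun i => x i ^ n) fun i => pow_mem (hxK i) n,
    mul_div_assoc',
    ← logHeight_pow]
  rfl

theorem absLogHeight_ratCast (x : ι → ℚ) :
    absLogHeight (fun i => algebraMap ℚ QBar (x i)) = logHeight x := by
  obtain ⟨K, hK, -⟩ := exists_numberField_of_finite Set.finite_empty
  have e := absLogHeight_coe K (fun i => algebraMap ℚ K (x i))
  rw [logHeight_algebraMap_div_finrank, Module.finrank_self, Nat.cast_one, div_one] at e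
  exact e

end absLogHeight

theorem weilHeight_nonneg {N : ℕ} (P : PN N) : 0 ≤ weilHeight P :=
  absLogHeight_nonneg P.rep

theorem weilHeight_mk {N : ℕ} (v : Fin (N + 1) → QBar) (hv : v ≠ 0) :
    weilHeight (Projectivization.mk QBar v hv) = absLogHeight v := by
  obtain ⟨a, ha⟩ := Projectivization.exists_smul_eq_mk_rep QBar v hv
  have h := absLogHeight_smul v a.ne_zero
  change absLogHeight (Projectivization.mk QBar v hv).rep = _
  rw [← h, ← ha]
  rfl

/-- For `N ≥ 1`, the Weil height is unbounded. -/
theorem exists_lt_weilHeight {N : ℕ} (hN : N ≠ 0) (C : ℝ) : ∃ P : PN N, C < weilHeight P := by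
  obtain ⟨n, rfl⟩ := Nat.exists_eq_succ_of_ne_zero hN
  -- The point [2 : 1 : … : 1] has height at least log 2, as its first two coordinates show; taking
  -- k-th powers of coordinates multiplies the height by k.
  let x : Fin (n + 1 + 1) → ℚ := fun i => if i = 0 then 2 else 1
  have hx : Real.log 2 ≤ logHeight x := by
    have h := logHeight_comp_le (![0, 1] : Fin 2 → Fin (n + 1 + 1)) x
    have e : x ∘ ![0, 1] = ![2, 1] := by
      funext i; fin_cases i <;> simp [x]
    rw [e, ← logHeight₁_eq_logHeight] at h
    simpa using (Rat.logHeight₁_natCast 2).symm.le.trans h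
  obtain ⟨k, hk⟩ := exists_nat_gt (C / Real.log 2)
  have h2 : 0 < Real.log 2 := Real.log_pos one_lt_two
  have hv : (fun i => algebraMap ℚ QBar (x i) ^ k) ≠ 0 :=
    Function.ne_iff.mpr ⟨1, by simp [x]⟩
  refine ⟨Projectivization.mk QBar _ hv, ?_⟩
  rw [weilHeight_mk, absLogHeight_pow (fun i => algebraMap ℚ QBar (x i)), absLogHeight_ratCast]
  exact ((div_lt_iff₀ h2).mp hk).trans_le (by gcongr)

/-! ### Heights of values of homogeneous forms -/

section Polynomials

open MvPolynomial

theorem exists_tuple_prod_eq {σ R : Type*} [Fintype σ] [CommSemiring R] (m : σ →₀ ℕ) :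
    ∃ I : Fin m.degree → σ, ∀ x : σ → R, ∏ a, x (I a) = ∏ i, x i ^ m i := by
  classical
  have hl : m.degree = m.toMultiset.toList.length := by
    rw [Multiset.length_toList, Finsupp.card_toMultiset]; rfl
  rw [hl]
  refine ⟨fun a => m.toMultiset.toList[a.1], fun x => ?_⟩
  rw [Fin.prod_univ_fun_getElem m.toMultiset.toList x, ← Multiset.prod_coe, ← Multiset.map_coe,
    Multiset.coe_toList, Finsupp.toMultiset_map, Finsupp.prod_toMultiset,
    Finsupp.prod_mapDomain_index (by simp) (by simp [pow_add]), Finsupp.prod_fintype _ _ (by simp)]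

/-- Choosing one index tuple per monomial turns a form into a linear functional on the d-th tensor
power, whose height is known exactly. -/
theorem isHomogeneous_exists_eval_eq_sum {σ R : Type*} [Fintype σ] [CommSemiring R] {d : ℕ}
    {p : MvPolynomial σ R} (hp : p.IsHomogeneous d) :
    ∃ A : (Fin d → σ) → R, ∀ x : σ → R, eval x p = ∑ I, A I * ∏ a, x (I a) := by
  classical
  have h : ∀ m : p.support, ∃ I : Fin d → σ, ∀ x : σ → R, ∏ a, x (I a) = ∏ i, x i ^ m.1 i := by
    intro m
    have hm : m.1.degree = d := by
      rw [Finsupp.degree_eq_weight_one]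
      exact hp (mem_support_iff.mp m.2)
    subst hm
    exact exists_tuple_prod_eq m.1
  choose J hJ using h
  refine ⟨fun I => ∑ m : p.support, if J m = I then coeff m.1 p else 0, fun x => ?_⟩
  simp_rw [Finset.sum_mul, ite_mul, zero_mul]
  rw [Finset.sum_comm, eval_eq', ← Finset.sum_coe_sort]
  simp [hJ]

theorem absLogHeight_eval_le {σ κ : Type*} [Fintype σ] [Finite κ] {d : ℕ}
    {F : κ → MvPolynomial σ QBar} (hF : ∀ j, (F j).IsHomogeneous d) :
    ∃ C : ℝ, ∀ x : σ → QBar, x ≠ 0 →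
      absLogHeight (fun j => eval x (F j)) ≤ C + d * absLogHeight x := by
  choose A hA using fun j => isHomogeneous_exists_eval_eq_sum (hF j)
  refine ⟨Real.log (Nat.card (Fin d → σ)) + absLogHeight (fun a : κ × (Fin d → σ) => A a.1 a.2),
    fun x hx => ?_⟩
  have h := absLogHeight_linearMap_apply_le (fun a : κ × (Fin d → σ) => A a.1 a.2)
    (fun I : Fin d → σ => ∏ a, x (I a))
  rw [absLogHeight_tensorPower hx] at h
  simpa only [hA] using h

/-- Multiplication by a form of degree `d` shifts the grading by `d`, so only one component of `q`
contributes. -/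
theorem homogeneousComponent_mul_of_isHomogeneous {σ R : Type*} [CommSemiring R] {d : ℕ}
    (q : MvPolynomial σ R) {p : MvPolynomial σ R} (hp : p.IsHomogeneous d) (n : ℕ) :
    homogeneousComponent (n + d) (q * p) = homogeneousComponent n q * p := by
  have h : ∀ i, homogeneousComponent (n + d) (homogeneousComponent i q * p) =
      if i = n then homogeneousComponent i q * p else 0 := by
    intro i
    rw [homogeneousComponent_of_mem
      (show _ ∈ homogeneousSubmodule σ R (i + d) from
        (homogeneousComponent_isHomogeneous i q).mul hp)]
    simp [eq_comm]
  conv_lhs => rw [← sum_homogeneousComponent q, Finset.sum_mul, map_sum]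
  simp_rw [h]
  rw [Finset.sum_ite_eq' (Finset.range (q.totalDegree + 1)) n
    fun i => homogeneousComponent i q * p]
  split_ifs with hn
  · rfl
  · rw [homogeneousComponent_eq_zero, zero_mul]
    rw [Finset.mem_range] at hn
    omega

/-- The projective Nullstellensatz: homogeneous forms without nontrivial common zero generate
an ideal containing a power of each variable. -/
theorem exists_pow_eq_sum_mul {k σ κ : Type*} [Field k] [IsAlgClosed k] [Fintype σ] [Fintype κ]
    {d : ℕ} {F : κ → MvPolynomial σ k} (hF : ∀ j, (F j).IsHomogeneous d)
    (h0 : ∀ v : σ → k, v ≠ 0 → (fun j => eval v (F j)) ≠ 0) :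
    ∃ (M : ℕ) (q : σ × κ → MvPolynomial σ k), (∀ a, (q a).IsHomogeneous M) ∧
      ∀ i, ∑ j, q (i, j) * F j = X i ^ (M + d) := by
  have hrad : ∀ i : σ, ∃ n, (X i : MvPolynomial σ k) ^ n ∈ Ideal.span (Set.range F) := by
    intro i
    suffices h : (X i : MvPolynomial σ k) ∈ (Ideal.span (Set.range F)).radical from h
    -- By the Nullstellensatz it suffices that `X i` vanishes on the common zeros, and the only
    -- possible one is the origin.
    rw [← vanishingIdeal_zeroLocus_eq_radical (K := k)]
    intro v hv
    have : v = 0 := by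
      by_contra hne
      refine h0 v hne (funext fun j => ?_)
      have := hv (F j) (Ideal.subset_span ⟨j, rfl⟩)
      rwa [← coe_aeval_eq_eval]
    simp [this]
  choose n hn using hrad
  -- The sum dominates every `n i`, so one exponent serves all variables.
  refine ⟨∑ i, n i, ?_⟩
  have hmem : ∀ i, (X i : MvPolynomial σ k) ^ (∑ i, n i + d) ∈ Ideal.span (Set.range F) := by
    intro i
    obtain ⟨c, hc⟩ := Nat.exists_eq_add_of_le
      ((Finset.single_le_sum (fun _ _ => Nat.zero_le _) (Finset.mem_univ i)).trans
        (Nat.le_add_right (∑ i, n i) d))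
    rw [hc, pow_add]
    exact Ideal.mul_mem_right _ _ (hn i)
  choose c hc using fun i => (Ideal.mem_span_range_iff_exists_fun).mp (hmem i)
  -- Taking the component of degree `∑ i, n i + d` of the ideal-membership identity makes all
  -- cofactors homogeneous of the same degree.
  refine ⟨fun a => homogeneousComponent (∑ i, n i) (c a.1 a.2),
    fun a => homogeneousComponent_isHomogeneous _ _, fun i => ?_⟩
  simp_rw [← homogeneousComponent_mul_of_isHomogeneous _ (hF _), ← map_sum, hc]
  exact homogeneousComponent_eq_self (by simpa using (isHomogeneous_X k i).pow _)

/-- The powers x_i^(M+d) are linear in F(x) with coefficients q(x), so (M+d) h(x) ≤ O(1) + h(q(x)) +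
h(F(x)). The upper bound h(q(x)) ≤ O(1) + M h(x) cancels the surplus M h(x). -/
theorem le_absLogHeight_eval {σ κ : Type*} [Fintype σ] [Fintype κ] {d : ℕ}
    {F : κ → MvPolynomial σ QBar} (hF : ∀ j, (F j).IsHomogeneous d)
    (h0 : ∀ v : σ → QBar, v ≠ 0 → (fun j => eval v (F j)) ≠ 0) :
    ∃ C : ℝ, ∀ x : σ → QBar, x ≠ 0 →
      d * absLogHeight x ≤ C + absLogHeight (fun j => eval x (F j)) := by
  obtain ⟨M, q, hq, h⟩ := exists_pow_eq_sum_mul hF h0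
  obtain ⟨C, hC⟩ := absLogHeight_eval_le hq
  refine ⟨Real.log (Nat.card κ) + C, fun x hx => ?_⟩
  have h1 := absLogHeight_linearMap_apply_le (fun a => eval x (q a)) (fun j => eval x (F j))
  have h2 : (fun i => ∑ j, eval x (q (i, j)) * eval x (F j)) = fun i => x i ^ (M + d) := by
    funext i
    simpa using congrArg (eval x) (h i)
  rw [h2, absLogHeight_pow, Nat.cast_add, add_mul] at h1
  linarith [hC x hx]

end Polynomials

/-! ### Height defect and degree of an endomorphism -/

theorem IsPresentedBy.exists_abs_weilHeight_sub_le {N : ℕ} {f : PN N → PN N} {d : ℕ}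
    {F : Fin (N + 1) → MvPolynomial (Fin (N + 1)) QBar} (h : IsPresentedBy f d F) :
    ∃ C : ℝ, ∀ P, |weilHeight (f P) - d * weilHeight P| ≤ C := by
  obtain ⟨C₁, h₁⟩ := absLogHeight_eval_le h.homogeneous
  obtain ⟨C₂, h₂⟩ := le_absLogHeight_eval h.homogeneous h.eval_ne_zero
  refine ⟨max C₁ C₂, fun P => ?_⟩
  induction P using Projectivization.ind with
  | h v hv =>
    rw [h.apply_mk v hv, weilHeight_mk, weilHeight_mk, abs_le]
    have := le_max_left C₁ C₂
    have := le_max_right C₁ C₂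
    constructor <;> linarith [h₁ v hv, h₂ v hv]

/-- For `N ≥ 1`, the degree of a presentation is determined by the map. -/
theorem IsPresentedBy.degree_unique {N : ℕ} (hN : N ≠ 0) {f : PN N → PN N} {d e : ℕ}
    {F G : Fin (N + 1) → MvPolynomial (Fin (N + 1)) QBar} (hF : IsPresentedBy f d F)
    (hG : IsPresentedBy f e G) : d = e := by
  obtain ⟨C₁, h₁⟩ := hF.exists_abs_weilHeight_sub_le
  obtain ⟨C₂, h₂⟩ := hG.exists_abs_weilHeight_sub_le
  by_contra hne
  obtain ⟨P, hP⟩ := exists_lt_weilHeight hN (C₁ + C₂)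
  have h3 : (1 : ℝ) ≤ |(d : ℝ) - e| := by
    have : (1 : ℤ) ≤ |(d : ℤ) - e| := Int.one_le_abs (by omega)
    exact_mod_cast this
  -- Both `d * weilHeight P` and `e * weilHeight P` approximate the height of `f P`; a point of
  -- large height then separates distinct degrees.
  have h4 : |(d : ℝ) - e| * weilHeight P ≤ C₁ + C₂ := by
    nth_rw 1 [← abs_of_nonneg (weilHeight_nonneg P)]
    rw [← abs_mul]
    have e1 := abs_le.mp (h₁ P)
    have e2 := abs_le.mp (h₂ P)
    rw [abs_le]
    constructor <;> linarith
  nlinarith [weilHeight_nonneg P]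

namespace Endo

variable {N : ℕ}

theorem bddAbove_abs_weilHeight_sub (f : Endo N) :
    BddAbove (Set.range fun P : PN N => |weilHeight (f P) - (f.degree : ℝ) * weilHeight P|) := by
  obtain ⟨F, hF⟩ := f.exists_presentation
  obtain ⟨C, hC⟩ := hF.exists_abs_weilHeight_sub_le
  exact ⟨C, by rintro _ ⟨P, rfl⟩; exact hC P⟩

theorem abs_weilHeight_sub_le_heightDefect (f : Endo N) (P : PN N) :
    |weilHeight (f P) - (f.degree : ℝ) * weilHeight P| ≤ f.heightDefect :=
  le_ciSup f.bddAbove_abs_weilHeight_sub P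

theorem degree_eq (hN : N ≠ 0) (f : Endo N) {d : ℕ}
    {F : Fin (N + 1) → MvPolynomial (Fin (N + 1)) QBar} (hF : IsPresentedBy f.toFun d F) :
    f.degree = d := by
  obtain ⟨G, hG⟩ := f.exists_presentation
  exact hG.degree_unique hN hF

theorem degree_comp (hN : N ≠ 0) (f g : Endo N) :
    (f.comp g).degree = g.degree * f.degree := by
  obtain ⟨F, hF⟩ := f.exists_presentation
  obtain ⟨G, hG⟩ := g.exists_presentation
  have h := isPresentedBy_comp hF hG
  exact degree_eq hN (f.comp g) h

theorem degree_id (hN : N ≠ 0) : (Endo.id : Endo N).degree = 1 := by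
  refine degree_eq hN _ (F := MvPolynomial.X) ⟨fun i => MvPolynomial.isHomogeneous_X _ i,
    fun v hv => ?_, fun v hv => ?_⟩
  · simpa only [MvPolynomial.eval_X] using hv
  · simp only [MvPolynomial.eval_X, Endo.id]

/-- Projective 0-space is a single point, so the constant form 1 presents its only self-map. Thus
degrees at least two force N ≥ 1. -/
theorem degree_eq_zero_of_eq_zero (f : Endo 0) : f.degree = 0 := by
  refine Nat.eq_zero_of_le_zero (Nat.sInf_le ⟨fun _ => 1, ⟨fun i => MvPolynomial.isHomogeneous_one _ _,
    fun v hv h => ?_, fun v hv => ?_⟩⟩)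
  · simpa using congrFun h 0
  · have hP : ∀ P Q : PN 0, P = Q := fun P Q => by
      induction P using Projectivization.ind with
      | h v hv =>
      induction Q using Projectivization.ind with
      | h w hw =>
      rw [Projectivization.mk_eq_mk_iff']
      have hw0 : w 0 ≠ 0 := fun h => hw (funext fun i => by rw [Fin.fin_one_eq_zero i, h]; rfl)
      exact ⟨v 0 / w 0, funext fun i => by
        rw [Fin.fin_one_eq_zero i]; simp [hw0]⟩
    exact hP _ _

end Endo

/-! ### Counting terms of rapidly growing sequences -/

section Counting

/-- If `a` is strictly increasing and `log (a n) / n → ℓ > 0`, then the number of terms of `a` up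
to `T` is asymptotic to `log T / ℓ`. -/
theorem tendsto_ncard_setOf_le_div_log {a : ℕ → ℝ} (ha : StrictMono a) (hpos : ∀ n, 0 < a n)
    {l : ℝ} (hl : 0 < l) (hlim : Tendsto (fun n : ℕ => Real.log (a n) / n) atTop (𝓝 l)) :
    Tendsto (fun T : ℝ => ({n | a n ≤ T}.ncard : ℝ) / Real.log T) atTop (𝓝 (1 / l)) := by
  have hlog : Tendsto (fun n : ℕ => Real.log (a n)) atTop atTop := by
    have h := hlim.pos_mul_atTop hl (tendsto_natCast_atTop_atTop (R := ℝ))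
    refine h.congr' ?_
    filter_upwards [eventually_gt_atTop 0] with n hn
    have : (n : ℝ) ≠ 0 := by positivity
    field_simp
  have hinf : Tendsto a atTop atTop :=
    (Real.tendsto_exp_atTop.comp hlog).congr fun n => Real.exp_log (hpos n)
  -- By monotonicity and unboundedness the indices counted form an initial segment, so their number
  -- is the first index with `T < a n`.
  have hseg : ∀ T : ℝ, {n | a n ≤ T} = Set.Iio {n | a n ≤ T}.ncard := by
    intro T
    obtain ⟨m, hm⟩ := (hinf.eventually_gt_atTop T).exists
    have hex : ∃ m, T < a m := ⟨m, hm⟩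
    classical
    have : {n | a n ≤ T} = Set.Iio (Nat.find hex) := by
      ext n
      simp only [Set.mem_ofPred_eq, Set.mem_Iio]
      constructor
      · intro h
        by_contra! hc
        exact absurd (Nat.find_spec hex) (not_lt.mpr ((ha.monotone hc).trans h))
      · intro h
        exact not_lt.mp (Nat.find_min hex h)
    rw [this]
    congr
    rw [← Finset.coe_Iio, Set.ncard_coe_finset, Nat.card_Iio]
  set K : ℝ → ℕ := fun T => {n | a n ≤ T}.ncard with hK
  have hiff : ∀ T n, n < K T ↔ a n ≤ T := fun T n => (Set.ext_iff.mp (hseg T) n).symm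
  have hKinf : Tendsto K atTop atTop := by
    refine tendsto_atTop.mpr fun n => ?_
    filter_upwards [eventually_ge_atTop (a n)] with T hT
    exact ((hiff T n).mpr hT).le
  -- The count `K T` satisfies `a (K T - 1) ≤ T < a (K T)` once positive; the shifted index supplies
  -- the lower side of the squeeze.
  have hlim' : Tendsto (fun n : ℕ => Real.log (a (n - 1)) / n) atTop (𝓝 l) := by
    rw [← tendsto_add_atTop_iff_nat 1]
    have h1 : Tendsto (fun n : ℕ => (n : ℝ) / (n + 1)) atTop (𝓝 1) :=
      tendsto_natCast_div_add_atTop 1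
    have h2 := hlim.mul h1
    rw [mul_one] at h2
    refine h2.congr' ?_
    filter_upwards [eventually_gt_atTop 0] with n hn
    have : (n : ℝ) ≠ 0 := by positivity
    simp only [Nat.add_sub_cancel, Nat.cast_add, Nat.cast_one]
    field_simp
  have hmain : Tendsto (fun T : ℝ => Real.log T / K T) atTop (𝓝 l) := by
    refine tendsto_of_tendsto_of_tendsto_of_le_of_le' (hlim'.comp hKinf) (hlim.comp hKinf) ?_ ?_
    · filter_upwards [hKinf.eventually_gt_atTop 0] with T hT
      simp only [Function.comp_apply]
      gcongr
      · exact hpos _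
      · exact (hiff T _).mp (Nat.sub_lt hT one_pos)
    · filter_upwards [eventually_gt_atTop 0] with T hT
      simp only [Function.comp_apply]
      gcongr
      exact (not_le.mp (mt (hiff T _).mpr (lt_irrefl _))).le
  simpa [hK] using hmain.inv₀ hl.ne'

/-- A sequence `a` within relative error `B / h < 1 / 3` of `h` times a sequence of integers that
at least doubles in each step is strictly increasing. -/
theorem strictMono_of_abs_sub_mul_le {a : ℕ → ℝ} {D : ℕ → ℝ} {h B : ℝ} (hB : 0 ≤ B)
    (hh : 3 * B < h) (hD0 : ∀ n, 0 < D n) (hD : ∀ n, 2 * D n ≤ D (n + 1))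
    (ha : ∀ n, |a n - D n * h| ≤ B * D n) : StrictMono a := by
  refine strictMono_nat_of_lt_succ fun n => ?_
  have h1 := abs_le.mp (ha n)
  have h2 := abs_le.mp (ha (n + 1))
  -- Source of the constant 3: the increment is at least 2 D_n (h - B) - D_n (h + B) = D_n (h - 3B).
  have h3 : 2 * D n * (h - B) ≤ D (n + 1) * (h - B) :=
    mul_le_mul_of_nonneg_right (hD n) (by linarith)
  have h4 : 0 < D n * (h - 3 * B) := mul_pos (hD0 n) (by linarith)
  linarith

/-- The logarithms of `a n` and `D n` differ by an amount between log(h - B) and log(h + B), which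
vanishes after division by `n`. -/
theorem tendsto_log_div_of_abs_sub_mul_le {a : ℕ → ℝ} {D : ℕ → ℝ} {h B l : ℝ} (hB : 0 ≤ B)
    (hh : B < h) (hD0 : ∀ n, 0 < D n) (ha : ∀ n, |a n - D n * h| ≤ B * D n)
    (hl : Tendsto (fun n : ℕ => Real.log (D n) / n) atTop (𝓝 l)) :
    Tendsto (fun n : ℕ => Real.log (a n) / n) atTop (𝓝 l) := by
  have hc : ∀ c : ℝ, Tendsto (fun n : ℕ => Real.log (D n) / n + c / n) atTop (𝓝 l) := fun c => by
    simpa using hl.add (tendsto_const_div_atTop_nhds_zero_nat c)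
  refine tendsto_of_tendsto_of_tendsto_of_le_of_le (hc (Real.log (h - B))) (hc (Real.log (h + B)))
    (fun n => ?_) (fun n => ?_)
  · have h1 := abs_le.mp (ha n)
    have h2 : 0 < h - B := by linarith
    simp only
    rw [← add_div, ← Real.log_mul (hD0 n).ne' h2.ne']
    have h3 : 0 < D n * (h - B) := mul_pos (hD0 n) h2
    gcongr
    linarith
  · have h1 := abs_le.mp (ha n)
    have h2 : 0 < h - B := by linarith
    have h3 : 0 < D n * (h - B) := mul_pos (hD0 n) h2
    simp only
    rw [← add_div, ← Real.log_mul (hD0 n).ne' (by linarith : h + B ≠ 0)]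
    gcongr <;> linarith

/-- Strictly increasing heights make `x` injective, so counting points of the range is counting
indices. -/
theorem tendsto_ncard_range_div_log {α : Type*} (ht : α → ℝ) {x : ℕ → α} {D : ℕ → ℝ} {h B l : ℝ}
    (hB : 0 ≤ B) (hh : 3 * B < h) (hD0 : ∀ n, 0 < D n) (hD : ∀ n, 2 * D n ≤ D (n + 1))
    (ha : ∀ n, |ht (x n) - D n * h| ≤ B * D n) (hl0 : 0 < l)
    (hl : Tendsto (fun n : ℕ => Real.log (D n) / n) atTop (𝓝 l)) :
    Tendsto (fun T : ℝ => ({Q ∈ Set.range x | ht Q ≤ T}.ncard : ℝ) / Real.log T) atTop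
      (𝓝 (1 / l)) := by
  have hmono : StrictMono fun n => ht (x n) := strictMono_of_abs_sub_mul_le hB hh hD0 hD ha
  have hinj : Function.Injective x := fun m n hmn => hmono.injective (congrArg ht hmn)
  have hpos : ∀ n, 0 < ht (x n) := fun n => by
    have h1 := abs_le.mp (ha n)
    have h3 : 0 < D n * (h - B) := mul_pos (hD0 n) (by linarith)
    linarith
  have key := tendsto_ncard_setOf_le_div_log hmono hpos hl0
    (tendsto_log_div_of_abs_sub_mul_le hB (by linarith) hD0 ha hl)
  have hset : ∀ T, {Q ∈ Set.range x | ht Q ≤ T} = x '' {n | ht (x n) ≤ T} := by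
    intro T
    ext Q
    constructor
    · rintro ⟨⟨n, rfl⟩, hn⟩
      exact ⟨n, hn, rfl⟩
    · rintro ⟨n, hn, rfl⟩
      exact ⟨⟨n, rfl⟩, hn⟩
  simpa only [hset, Set.ncard_image_of_injective _ hinj] using key

end Counting

/-! ### Heights and degrees along random iterates -/

variable {N : ℕ}

/-- The errors telescope: deg(f) · B (deg(g) - 1) + B (deg(f) - 1) = B (deg(f) deg(g) - 1). The
bound is symmetric in f and g, hence serves left and right iteration alike. -/
theorem Endo.abs_weilHeight_comp_sub_le (hN : N ≠ 0) {f g : Endo N} {B : ℝ}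
    (hf : ∀ P, |weilHeight (f P) - f.degree * weilHeight P| ≤ B * (f.degree - 1))
    (hg : ∀ P, |weilHeight (g P) - g.degree * weilHeight P| ≤ B * (g.degree - 1)) (P : PN N) :
    |weilHeight (f.comp g P) - (f.comp g).degree * weilHeight P| ≤
      B * ((f.comp g).degree - 1) := by
  have h1 := abs_le.mp (hf (g P))
  have h2 := abs_le.mp (hg P)
  have h3 : f.comp g P = f (g P) := rfl
  have hd : (0 : ℝ) ≤ f.degree := Nat.cast_nonneg _
  have h4 := mul_le_mul_of_nonneg_left h2.1 hd
  have h5 := mul_le_mul_of_nonneg_left h2.2 hd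
  rw [h3, degree_comp hN, Nat.cast_mul, abs_le]
  constructor <;> linarith

section Iteration

variable {S : Finset (Endo N)}

theorem minDegree_le {φ : Endo N} (hφ : φ ∈ S) : minDegree S ≤ φ.degree :=
  Nat.sInf_le ⟨φ, hφ, rfl⟩

theorem two_le_minDegree (hne : S.Nonempty) (hS : ∀ φ ∈ S, 2 ≤ φ.degree) : 2 ≤ minDegree S := by
  obtain ⟨φ, hφ, h⟩ := Nat.sInf_mem (s := Endo.degree '' (S : Set (Endo N)))
    (by simpa using hne)
  rw [minDegree, ← h]
  exact hS φ hφ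

theorem heightDefect_le_maxDefect {φ : Endo N} (hφ : φ ∈ S) : φ.heightDefect ≤ maxDefect S :=
  le_csSup ((S.finite_toSet.image _).bddAbove) ⟨φ, hφ, rfl⟩

theorem maxDefect_nonneg : 0 ≤ maxDefect S := by
  refine Real.sSup_nonneg ?_
  rintro _ ⟨φ, -, rfl⟩
  exact Real.iSup_nonneg fun P => abs_nonneg _

theorem escapeConst_nonneg (hne : S.Nonempty) (hS : ∀ φ ∈ S, 2 ≤ φ.degree) :
    0 ≤ escapeConst S := by
  have : (2 : ℝ) ≤ minDegree S := by exact_mod_cast two_le_minDegree hne hS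
  exact div_nonneg maxDefect_nonneg (by linarith)

/-- Dividing by d_S - 1 in B_S is what puts the uniform defect into the composable form: C_S = B_S
(d_S - 1) ≤ B_S (deg(φ) - 1). -/
theorem abs_weilHeight_sub_le_of_mem (hS : ∀ φ ∈ S, 2 ≤ φ.degree) {φ : Endo N} (hφ : φ ∈ S)
    (P : PN N) :
    |weilHeight (φ P) - φ.degree * weilHeight P| ≤ escapeConst S * (φ.degree - 1) := by
  have h1 : (2 : ℝ) ≤ minDegree S := by exact_mod_cast two_le_minDegree ⟨φ, hφ⟩ hS
  have h2 : (minDegree S : ℝ) ≤ φ.degree := by exact_mod_cast minDegree_le hφ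
  calc _ ≤ φ.heightDefect := φ.abs_weilHeight_sub_le_heightDefect P
    _ ≤ maxDefect S := heightDefect_le_maxDefect hφ
    _ = escapeConst S * (minDegree S - 1) := by
      rw [escapeConst, div_mul_cancel₀ _ (by linarith)]
    _ ≤ escapeConst S * (φ.degree - 1) := by
      gcongr
      exact escapeConst_nonneg ⟨φ, hφ⟩ hS

theorem abs_weilHeight_id_sub_le (hN : N ≠ 0) (B : ℝ) (P : PN N) :
    |weilHeight ((Endo.id : Endo N) P) - (Endo.id : Endo N).degree * weilHeight P| ≤
      B * ((Endo.id : Endo N).degree - 1) := by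
  rw [Endo.degree_id hN]
  simp [Endo.id]

theorem abs_weilHeight_leftIter_sub_le (hN : N ≠ 0) (hS : ∀ φ ∈ S, 2 ≤ φ.degree) (γ : ℕ → S)
    (n : ℕ) (P : PN N) :
    |weilHeight (leftIter γ n P) - (leftIter γ n).degree * weilHeight P| ≤
      escapeConst S * ((leftIter γ n).degree - 1) := by
  induction n generalizing P with
  | zero => exact abs_weilHeight_id_sub_le hN _ P
  | succ n ih =>
    exact Endo.abs_weilHeight_comp_sub_le hN (abs_weilHeight_sub_le_of_mem hS (γ n).2) ih P

theorem abs_weilHeight_rightIter_sub_le (hN : N ≠ 0) (hS : ∀ φ ∈ S, 2 ≤ φ.degree) (γ : ℕ → S)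
    (n : ℕ) (P : PN N) :
    |weilHeight (rightIter γ n P) - (rightIter γ n).degree * weilHeight P| ≤
      escapeConst S * ((rightIter γ n).degree - 1) := by
  induction n generalizing P with
  | zero => exact abs_weilHeight_id_sub_le hN _ P
  | succ n ih =>
    exact Endo.abs_weilHeight_comp_sub_le hN ih (abs_weilHeight_sub_le_of_mem hS (γ n).2) P

theorem degree_leftIter (hN : N ≠ 0) (γ : ℕ → S) (n : ℕ) :
    (leftIter γ n).degree = ∏ i ∈ Finset.range n, (γ i : Endo N).degree := by
  induction n with
  | zero => exact Endo.degree_id hN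
  | succ n ih => rw [leftIter, Endo.degree_comp hN, ih, Finset.prod_range_succ]

theorem degree_rightIter (hN : N ≠ 0) (γ : ℕ → S) (n : ℕ) :
    (rightIter γ n).degree = ∏ i ∈ Finset.range n, (γ i : Endo N).degree := by
  induction n with
  | zero => exact Endo.degree_id hN
  | succ n ih => rw [rightIter, Endo.degree_comp hN, ih, Finset.prod_range_succ, mul_comm]

instance : DiscreteMeasurableSpace S where
  forall_measurableSet s := ⟨Subtype.val '' s, trivial, Set.preimage_image_eq _ Subtype.val_injective⟩

/-- The strong law of large numbers for the degrees of a random sequence of maps. -/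
theorem ae_tendsto_sum_log_degree_div (ν : Measure S) [IsProbabilityMeasure ν] :
    ∀ᵐ γ ∂(seqMeasure ν), Tendsto
      (fun n : ℕ => (∑ i ∈ Finset.range n, Real.log ((γ i : Endo N).degree)) / n) atTop
      (𝓝 (∑ φ : S, ν.real {φ} * Real.log ((φ : Endo N).degree))) := by
  have : IsProbabilityMeasure (seqMeasure ν) := by unfold seqMeasure; infer_instance
  let f : S → ℝ := fun φ => Real.log ((φ : Endo N).degree)
  have hf : Measurable f := measurable_of_finite f
  have hmap : ∀ i, (seqMeasure ν).map (fun γ : ℕ → S => γ i) = ν := fun i =>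
    Measure.infinitePi_map_eval (fun _ : ℕ => ν) i
  have hint : Integrable f ν := Integrable.of_finite
  have hmp : ∀ i, MeasurePreserving (fun γ : ℕ → S => γ i) (seqMeasure ν) ν := fun i =>
    ⟨measurable_pi_apply i, hmap i⟩
  have hident : ∀ i, ProbabilityTheory.IdentDistrib (fun γ : ℕ → S => f (γ i))
      (fun γ => f (γ 0)) (seqMeasure ν) (seqMeasure ν) := fun i =>
    { aemeasurable_fst := (hf.comp (measurable_pi_apply i)).aemeasurable
      aemeasurable_snd := (hf.comp (measurable_pi_apply 0)).aemeasurable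
      map_eq := by
        change Measure.map (f ∘ fun γ : ℕ → S => γ i) _ = Measure.map (f ∘ fun γ : ℕ → S => γ 0) _
        rw [← Measure.map_map hf (measurable_pi_apply i), hmap,
          ← Measure.map_map hf (measurable_pi_apply 0), hmap] }
  have hindep : ProbabilityTheory.iIndepFun (fun (i : ℕ) (γ : ℕ → S) => f (γ i))
      (seqMeasure ν) :=
    ProbabilityTheory.iIndepFun_infinitePi (P := fun _ : ℕ => ν) (X := fun _ => f) fun _ => hf
  have h := ProbabilityTheory.strong_law_ae_real (fun (i : ℕ) (γ : ℕ → S) => f (γ i))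
    ((hmp 0).integrable_comp_of_integrable hint) (fun i j hij => hindep.indepFun hij) hident
  have hE : ∫ γ, f (γ 0) ∂(seqMeasure ν) = ∑ φ : S, ν.real {φ} * f φ := by
    have e := integral_map (μ := seqMeasure ν) (φ := fun γ : ℕ → S => γ 0)
      (measurable_pi_apply 0).aemeasurable (f := f) hf.aestronglyMeasurable
    rw [← e, hmap, integral_fintype hint]
    rfl
  rw [hE] at h
  exact h

end Iteration

/-! ### From the law of large numbers to orbit counts -/

variable {S : Finset (Endo N)}

theorem tendsto_rpow_inv_of_tendsto_log_div {D : ℕ → ℝ} (hD : ∀ n, 0 < D n) {δ : ℝ} (hδ : 0 < δ)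
    (h : Tendsto (fun n : ℕ => Real.log (D n) / n) atTop (𝓝 (Real.log δ))) :
    Tendsto (fun n : ℕ => D n ^ (1 / (n : ℝ))) atTop (𝓝 δ) := by
  have h1 := (Real.continuous_exp.tendsto _).comp h
  rw [Real.exp_log hδ] at h1
  refine h1.congr fun n => ?_
  rw [Function.comp_apply, Real.rpow_def_of_pos (hD n), mul_one_div]

theorem tendsto_log_prod_degree_div (hS : ∀ φ ∈ S, 2 ≤ φ.degree) {γ : ℕ → S} {l : ℝ}
    (h : Tendsto (fun n : ℕ => (∑ i ∈ Finset.range n, Real.log ((γ i : Endo N).degree)) / n) atTop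
      (𝓝 l)) :
    Tendsto (fun n : ℕ => Real.log ((∏ i ∈ Finset.range n, (γ i : Endo N).degree : ℕ) : ℝ) / n)
      atTop (𝓝 l) := by
  refine h.congr fun n => ?_
  rw [Nat.cast_prod, Real.log_prod]
  intro i _
  have := hS _ (γ i).2
  exact Nat.cast_ne_zero.mpr (by omega)

theorem log_prod_degree_rpow (hS : ∀ φ ∈ S, 2 ≤ φ.degree) (p : S → ℝ) :
    Real.log (∏ φ : S, ((φ : Endo N).degree : ℝ) ^ p φ) =
      ∑ φ : S, p φ * Real.log ((φ : Endo N).degree) := by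
  have hpos : ∀ φ : S, (0 : ℝ) < (φ : Endo N).degree := fun φ => by
    have := hS φ φ.2
    exact Nat.cast_pos.mpr (by omega)
  rw [Real.log_prod fun φ _ => (Real.rpow_pos_of_pos (hpos φ) _).ne']
  exact Finset.sum_congr rfl fun φ _ => Real.log_rpow (hpos φ) _

/-- An average of numbers at least log 2 is at least log 2; this permits division by log δ in the
count. -/
theorem sum_measureReal_mul_log_degree_pos (hS : ∀ φ ∈ S, 2 ≤ φ.degree) (ν : Measure S)
    [IsProbabilityMeasure ν] :
    0 < ∑ φ : S, ν.real {φ} * Real.log ((φ : Endo N).degree) := by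
  have h1 : ∑ φ : S, ν.real {φ} = 1 := by
    rw [sum_measureReal_singleton, Finset.coe_univ, probReal_univ]
  calc 0 < Real.log 2 := Real.log_pos one_lt_two
    _ = ∑ φ : S, ν.real {φ} * Real.log 2 := by rw [← Finset.sum_mul, h1, one_mul]
    _ ≤ _ := by
      refine Finset.sum_le_sum fun φ _ => mul_le_mul_of_nonneg_left ?_ measureReal_nonneg
      exact Real.log_le_log two_pos (by exact_mod_cast hS φ φ.2)

/-- The count of points of bounded height along an iteration whose degrees are the partial products
of the degrees of `γ`. -/
theorem tendsto_ncard_orbit_div_log (hS : ∀ φ ∈ S, 2 ≤ φ.degree) {γ : ℕ → S}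
    {it : ℕ → Endo N} (hdeg : ∀ n, (it n).degree = ∏ i ∈ Finset.range n, (γ i : Endo N).degree)
    (hit : ∀ n P, |weilHeight (it n P) - (it n).degree * weilHeight P| ≤
      escapeConst S * ((it n).degree - 1)) {l : ℝ} (hl0 : 0 < l)
    (hl : Tendsto (fun n : ℕ => Real.log ((it n).degree : ℝ) / n) atTop (𝓝 l)) {P : PN N}
    (hP : 3 * escapeConst S < weilHeight P) :
    Tendsto (fun B : ℝ => ({Q ∈ Set.range fun n => it n P | weilHeight Q ≤ B}.ncard : ℝ) /
      Real.log B) atTop (𝓝 (1 / l)) := by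
  have hB := escapeConst_nonneg ⟨_, (γ 0).2⟩ hS
  have hpos : ∀ n, 0 < (it n).degree := fun n => by
    rw [hdeg]
    exact Finset.prod_pos fun i _ => lt_of_lt_of_le two_pos (hS _ (γ i).2)
  refine tendsto_ncard_range_div_log weilHeight (D := fun n => ((it n).degree : ℝ)) hB hP
    (fun n => Nat.cast_pos.mpr (hpos n)) (fun n => ?_)
    (fun n => (hit n P).trans (mul_le_mul_of_nonneg_left (by linarith) hB)) hl0 hl
  have : 2 * (it n).degree ≤ (it (n + 1)).degree := by
    rw [hdeg, hdeg, Finset.prod_range_succ, mul_comm]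
    exact Nat.mul_le_mul_left _ (hS _ (γ n).2)
  exact_mod_cast this

end ProjDyn

open ProjDyn
theorem corollary1p5 {N : ℕ} (S : Finset (Endo N)) (hS : ∀ φ ∈ S, 2 ≤ φ.degree)
    (ν : Measure S) [IsProbabilityMeasure ν] :
    -- the constant `B_S` is finite: each supremum `C(φ)` that enters it is one of a bounded set
    (∀ φ ∈ S, BddAbove (Set.range fun P : PN N =>
      |weilHeight (φ P) - (φ.degree : ℝ) * weilHeight P|)) ∧
    -- the dynamical degree exists and is the weighted geometric mean of the degrees
    ∃ δ : ℝ, IsDynamicalDegree ν δ ∧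
      δ = ∏ φ : S, ((φ : Endo N).degree : ℝ) ^ (ν.real {φ}) ∧
      -- the asymptotic count of points of bounded height in generic left and right orbits
      ∀ᵐ γ ∂(seqMeasure ν), ∀ P : PN N, 3 * escapeConst S < weilHeight P →
        Tendsto (fun B : ℝ => ({Q ∈ leftOrbit γ P | weilHeight Q ≤ B}.ncard : ℝ) / Real.log B)
          atTop (𝓝 (1 / Real.log δ)) ∧
        Tendsto (fun B : ℝ => ({Q ∈ rightOrbit γ P | weilHeight Q ≤ B}.ncard : ℝ) / Real.log B)
          atTop (𝓝 (1 / Real.log δ)) := by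
  -- A probability measure needs a nonempty `S`, and one map of degree at least two excludes `N =
  -- 0`.
  obtain ⟨φ₀⟩ : Nonempty S := nonempty_of_isProbabilityMeasure ν
  have hN : N ≠ 0 := by
    rintro rfl
    have := hS φ₀ φ₀.2
    rw [Endo.degree_eq_zero_of_eq_zero] at this
    omega
  have hpos : ∀ φ : S, (0 : ℝ) < (φ : Endo N).degree := fun φ => by
    have := hS φ φ.2
    exact Nat.cast_pos.mpr (by omega)
  have hδ : 0 < ∏ φ : S, ((φ : Endo N).degree : ℝ) ^ (ν.real {φ}) :=
    Finset.prod_pos fun φ _ => Real.rpow_pos_of_pos (hpos φ) _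
  have hlogδ := log_prod_degree_rpow hS fun φ => ν.real {φ}
  have hl0 := sum_measureReal_mul_log_degree_pos hS ν
  rw [← hlogδ] at hl0
  have hslln := ae_tendsto_sum_log_degree_div ν
  rw [← hlogδ] at hslln
  have hprod : ∀ (γ : ℕ → S) (n : ℕ),
      (0 : ℝ) < (∏ i ∈ Finset.range n, (γ i : Endo N).degree : ℕ) := fun γ n =>
    Nat.cast_pos.mpr (Finset.prod_pos fun i _ => Nat.cast_pos.mp (hpos (γ i)))
  refine ⟨fun φ _ => φ.bddAbove_abs_weilHeight_sub, _, ?_, rfl, ?_⟩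
  · unfold IsDynamicalDegree
    filter_upwards [hslln] with γ hγ
    have h := tendsto_rpow_inv_of_tendsto_log_div (hprod γ) hδ (tendsto_log_prod_degree_div hS hγ)
    simp only [degree_leftIter hN, degree_rightIter hN]
    exact ⟨h, h⟩
  -- The exceptional null set concerns only the degrees, so a single one works for all `P`.
  · filter_upwards [hslln] with γ hγ P hP
    have h := tendsto_log_prod_degree_div hS hγ
    exact ⟨tendsto_ncard_orbit_div_log hS (degree_leftIter hN γ)
        (abs_weilHeight_leftIter_sub_le hN hS γ) hl0 (by simpa only [degree_leftIter hN] using h) hP,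
      tendsto_ncard_orbit_div_log hS (degree_rightIter hN γ)
        (abs_weilHeight_rightIter_sub_le hN hS γ) hl0
        (by simpa only [degree_rightIter hN] using h) hP⟩
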